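/- Let $\Gamma$ be a finitely generated group and $\mathcal P$ a finite collection of finitely generated infinite subgroups of $\Gamma$; write $\mathcal P^\Gamma=\{\gamma P\gamma^{-1}:\gamma\in\Gamma,\ P\in\mathcal P\}$. A geodesic metric space $X$ is taut if there is $R\ge 0$ such that every point of $X$ is within distance $R$ of some bi-infinite geodesic. An open horoball of $X$ is an open subset $B$ for which there are a geodesic ray with Busemann function $b$ and a constant $C$ such that $b\le C$ on $B$ and $b\ge -C$ on $X\setminus B$. A Gromov model of $(\Gamma,\mathcal P)$ is a taut, geodesic, Gromov hyperbolic metric space $(X,d_X)$ with a properly discontinuous action of $\Gamma$ by isometries and pairwise disjoint open horoballs $B_P$ $(P\in\mathcal P^\Gamma)$, such that $\gamma B_P=B_{\gamma P\gamma^{-1}}$ for all $\gamma\in\Gamma$, the stabilizer of $B_P$ in $\Gamma$ is $P$, and $\Gamma$ acts cocompactly on $X\setminus\bigcup_{P\in\mathcal P^\Gamma}B_P$. Let $S$ be a finite symmetric generating set of $\Gamma$ such that $S\cap P$ generates $P$ for each $P\in\mathcal P$, let $|\gamma|_S$ denote the word length with respect to $S$, and let $\log_2^+ t=\max(\log_2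 t,0)$, with $\log_2^+0=0$. Let $X$ be a Gromov model of $(\Gamma,\mathcal P)$, let $o\in X$ be a base point, and put $|\gamma|_X=d_X(o,\gamma o)$ for $\gamma\in\Gamma$. Then there exist constants $\lambda\ge 1$ and $\epsilon\ge 0$ such that \[ |\gamma|_X\le\lambda\,\log_2^+|\gamma|_S+\epsilon\qquad\text{for all } P\in\mathcal P \text{ and } \gamma\in P . \] -/

import Mathlib

open scoped Pointwise

namespace RelHyp

noncomputable section

/-- Every two points are joined by a geodesic segment. -/
def IsGeodesicSpace (X : Type*) [MetricSpace X] : Prop :=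
  ∀ x y : X, ∃ c : ℝ → X, c 0 = x ∧ c (dist x y) = y ∧
    ∀ s ∈ Set.Icc 0 (dist x y), ∀ t ∈ Set.Icc 0 (dist x y), dist (c s) (c t) = |s - t|

/-- The Gromov product `(x | y)_w`. -/
def gromovProduct {X : Type*} [MetricSpace X] (w x y : X) : ℝ :=
  (dist x w + dist y w - dist x y) / 2

/-- Gromov hyperbolicity, by the inequality for Gromov products. -/
def IsGromovHyperbolic (X : Type*) [MetricSpace X] : Prop :=
  ∃ δ : ℝ, 0 ≤ δ ∧ ∀ w x y z : X,
    min (gromovProduct w x y) (gromovProduct w y z) - δ ≤ gromovProduct w x z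

/-- Every point lies at uniformly bounded distance from some bi-infinite geodesic. -/
def IsTaut (X : Type*) [MetricSpace X] : Prop :=
  ∃ R : ℝ, 0 ≤ R ∧ ∀ x : X, ∃ ℓ : ℝ → X, Isometry ℓ ∧ ∃ t : ℝ, dist x (ℓ t) ≤ R

/-- The restriction of `σ` to `[0, ∞)` is a geodesic ray. -/
def IsGeodesicRay {X : Type*} [MetricSpace X] (σ : ℝ → X) : Prop :=
  ∀ s t : ℝ, 0 ≤ s → 0 ≤ t → dist (σ s) (σ t) = |s - t|

/-- The Busemann function of a geodesic ray. -/
def busemann {X : Type*} [MetricSpace X] (σ : ℝ → X) (x : X) : ℝ :=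
  Filter.limUnder Filter.atTop fun t : ℝ => dist x (σ t) - t

/-- The limit that defines the Busemann function of a geodesic ray always exists. -/
theorem tendsto_busemann {X : Type*} [MetricSpace X] {σ : ℝ → X} (hσ : IsGeodesicRay σ) (x : X) :
    Filter.Tendsto (fun t : ℝ => dist x (σ t) - t) Filter.atTop (nhds (busemann σ x)) := by
  apply tendsto_nhds_limUnder
  have hanti : Antitone fun t : ℝ => dist x (σ (max t 0)) - max t 0 := by
    intro s t hst
    have h0 : max s 0 ≤ max t 0 := max_le_max_right 0 hst
    have h1 := hσ (max s 0) (max t 0) (le_max_right _ _) (le_max_right _ _)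
    rw [abs_sub_comm, abs_of_nonneg (sub_nonneg.mpr h0)] at h1
    have h2 := dist_triangle x (σ (max s 0)) (σ (max t 0))
    simp only
    linarith
  have hbdd : BddBelow (Set.range fun t : ℝ => dist x (σ (max t 0)) - max t 0) := by
    refine ⟨-dist x (σ 0), ?_⟩
    rintro _ ⟨t, rfl⟩
    have h1 := hσ 0 (max t 0) le_rfl (le_max_right _ _)
    rw [abs_sub_comm, sub_zero, abs_of_nonneg (le_max_right t 0)] at h1
    have h2 := dist_triangle_left (σ 0) (σ (max t 0)) x
    simp only
    linarith
  refine ⟨_, (tendsto_atTop_ciInf hanti hbdd).congr' ?_⟩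
  filter_upwards [Filter.eventually_ge_atTop (0 : ℝ)] with t ht
  rw [max_eq_left ht]

/-- An open horoball: an open set which is, up to a bounded error, a sublevel set of the Busemann
function `b` of a geodesic ray, that is, `b ≤ C` on `B` and `b ≥ -C` off `B` for some constant `C`.
In a Gromov hyperbolic space horofunctions at a boundary point are only determined up to bounded
error, and this is the customary notion of a horoball in the theory of relatively hyperbolic groups.
It contains the exact open sublevel sets `{b < c}`, and it allows for the horoballs of the
combinatorial cusp spaces, which are invariant under a group that preserves `b` only coarsely. -/
def IsOpenHoroball {X : Type*} [MetricSpace X] (B : Set X) : Prop :=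
  IsOpen B ∧ ∃ σ : ℝ → X, IsGeodesicRay σ ∧ ∃ C : ℝ,
    (∀ x ∈ B, busemann σ x ≤ C) ∧ ∀ x ∉ B, -C ≤ busemann σ x

variable {Γ : Type*} [Group Γ]

/-- The collection `Pc^Γ` of all conjugates of the subgroups in `Pc`. -/
def conjugates (Pc : Set (Subgroup Γ)) : Set (Subgroup Γ) :=
  {Q | ∃ γ : Γ, ∃ P ∈ Pc, Q = MulAut.conj γ • P}

/-- The thick part: the complement of the horoballs `B P`, `P ∈ Pc^Γ`. -/
def thickPart {X : Type*} (Pc : Set (Subgroup Γ)) (B : Subgroup Γ → Set X) : Set X :=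
  (⋃ P ∈ conjugates Pc, B P)ᶜ

/-- The sets `B P`, for `P ∈ Pc^Γ`, are the horoballs of a thick-thin decomposition of `X` (the
values of `B` at other subgroups are irrelevant). -/
structure IsThickThin {X : Type*} [MetricSpace X] [MulAction Γ X]
    (Pc : Set (Subgroup Γ)) (B : Subgroup Γ → Set X) : Prop where
  horoball : ∀ P ∈ conjugates Pc, IsOpenHoroball (B P)
  disjoint : ∀ P ∈ conjugates Pc, ∀ Q ∈ conjugates Pc, P ≠ Q → Disjoint (B P) (B Q)
  equivariant : ∀ γ : Γ, ∀ P ∈ conjugates Pc, γ • B P = B (MulAut.conj γ • P)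
  stabilizer : ∀ P ∈ conjugates Pc, MulAction.stabilizer Γ (B P) = P
  cocompact : ∃ K : Set X, IsCompact K ∧ (⋃ γ : Γ, γ • K) = thickPart Pc B

/-- `X` with its `Γ`-action is a Gromov model of `(Γ, Pc)`; in particular `(Γ, Pc)` is a relatively
hyperbolic group. -/
structure IsGromovModel (Pc : Set (Subgroup Γ)) (X : Type*) [MetricSpace X] [MulAction Γ X] :
    Prop where
  group_fg : Group.FG Γ
  finite : Pc.Finite
  peripheral_fg : ∀ P ∈ Pc, P.FG
  peripheral_infinite : ∀ P ∈ Pc, Infinite P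
  geodesic : IsGeodesicSpace X
  hyperbolic : IsGromovHyperbolic X
  taut : IsTaut X
  isometric : IsIsometricSMul Γ X
  properlyDiscontinuous : ProperlyDiscontinuousSMul Γ X
  thickThin : ∃ B : Subgroup Γ → Set X, IsThickThin Pc B

/-- An adapted generating set of `(Γ, Pc)`. -/
structure IsAdapted (Pc : Set (Subgroup Γ)) (S : Set Γ) : Prop where
  finite : S.Finite
  symmetric : ∀ s ∈ S, s⁻¹ ∈ S
  generates : Subgroup.closure S = ⊤
  generates_peripheral : ∀ P ∈ Pc, Subgroup.closure (S ∩ (P : Set Γ)) = P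

/-- The word length `|γ|_S`, for a symmetric generating set `S`. -/
def wordLength (S : Set Γ) (γ : Γ) : ℕ :=
  sInf {n | ∃ l : List Γ, l.length = n ∧ (∀ s ∈ l, s ∈ S) ∧ l.prod = γ}

/-- `|γ|_X = d(o, γ o)` for the base point `o`. -/
def orbitNorm {X : Type*} [MetricSpace X] [MulAction Γ X] (o : X) (γ : Γ) : ℝ :=
  dist o (γ • o)

/-- `log₂⁺ x = max (log₂ x) 0`; at `x = 0` the value is `0`. -/
def logTwoPlus (x : ℝ) : ℝ :=
  max (Real.logb 2 x) 0

end

end RelHyp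

/-!
Let `b` be the Busemann function of a ray defining a horoball `B_P`. By hyperbolicity, the midpoint
`m` of two points `x`, `y` with `b ≤ M` satisfies `b m ≤ M - d(x, y) / 2 + 2δ`; for `x = o` and
`y = γ o` with `γ ∈ P`, `M` does not depend on `γ`, so `m` lies at depth at least about `|γ|_X / 2`.
On the other hand a word of length `n` for `γ` gives a path of `n` bounded steps from `o` to `γ o`
through the `Γ`-orbit of `o`, on which `b` is bounded below, and repeated halving of this path shows
that it passes within about `δ log₂ n` of `m`. Comparing the two bounds gives
`|γ|_X ≤ 2δ log₂ n + const`. The lower bound on the orbit needs a point outside all the horoballs: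
it exists because `X` is connected, while a bi-infinite geodesic does not fit in a single horoball.
-/

namespace RelHyp

theorem biUnion_ne_univ_of_pairwiseDisjoint {ι Y : Type*} [TopologicalSpace Y] [PreconnectedSpace Y]
    {s : Set ι} {U : ι → Set Y} (hU : ∀ i ∈ s, IsOpen (U i)) (hs : s.PairwiseDisjoint U)
    {i : ι} (hi : i ∈ s) (hne : (U i).Nonempty) (hproper : U i ≠ Set.univ) :
    ⋃ j ∈ s, U j ≠ Set.univ := by
  intro hcover
  have hrest : IsOpen (⋃ j ∈ s \ {i}, U j) := isOpen_biUnion fun j hj => hU j hj.1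
  have hdisj : Disjoint (U i) (⋃ j ∈ s \ {i}, U j) :=
    Set.disjoint_iUnion₂_right.mpr fun j hj => hs hi hj.1 (Ne.symm hj.2)
  have hunion : Set.univ ⊆ U i ∪ ⋃ j ∈ s \ {i}, U j := by
    rw [← Set.biUnion_insert, Set.insert_sdiff_singleton, Set.insert_eq_of_mem hi, hcover]
  exact hproper <| Set.univ_subset_iff.mp <|
    isPreconnected_univ.subset_left_of_subset_union (hU i hi) hrest hdisj hunion (by simpa)

section Metric

variable {X : Type*} [MetricSpace X] {δ : ℝ} {σ : ℝ → X}

/-- Gromov hyperbolicity with the constant `δ` of the Gromov product inequality made explicit. -/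
def IsGromovHyperbolicWith (X : Type*) [MetricSpace X] (δ : ℝ) : Prop :=
  ∀ w x y z : X, min (gromovProduct w x y) (gromovProduct w y z) - δ ≤ gromovProduct w x z

theorem IsGromovHyperbolicWith.dist_add_dist_le (h : IsGromovHyperbolicWith X δ) (x y z w : X) :
    dist x z + dist y w ≤ max (dist x y + dist z w) (dist y z + dist x w) + 2 * δ := by
  have hw := h w x y z
  simp only [gromovProduct] at hw
  rcases min_le_iff.mp (sub_le_iff_le_add.mp hw) with hxy | hyz
  · linarith [le_max_left (dist x y + dist z w) (dist y z + dist x w)]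
  · linarith [le_max_right (dist x y + dist z w) (dist y z + dist x w)]

theorem IsGromovHyperbolicWith.exists_dist_le_gromovProduct_add (h : IsGromovHyperbolicWith X δ)
    {x : ℕ → X} {L : ℝ} (hL : ∀ i, dist (x i) (x (i + 1)) ≤ L) (w : X) (k a : ℕ) :
    ∃ i, dist (x i) w ≤ gromovProduct w (x a) (x (a + 2 ^ k)) + k * δ + L := by
  induction k generalizing a with
  | zero =>
    refine ⟨a, ?_⟩
    have htri := dist_triangle (x a) (x (a + 1)) w
    simp only [gromovProduct, pow_zero, Nat.cast_zero, zero_mul, add_zero]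
    linarith [hL a]
  | succ k ih =>
    have hhalf := h w (x a) (x (a + 2 ^ k)) (x (a + 2 ^ (k + 1)))
    push_cast
    rcases min_le_iff.mp (sub_le_iff_le_add.mp hhalf) with hfirst | hsecond
    · obtain ⟨i, hi⟩ := ih a
      exact ⟨i, by linarith⟩
    · obtain ⟨i, hi⟩ := ih (a + 2 ^ k)
      rw [add_assoc a, ← two_mul, ← pow_succ'] at hi
      exact ⟨i, by linarith⟩

theorem IsGeodesicSpace.exists_midpoint (hX : IsGeodesicSpace X) (x y : X) :
    ∃ m, dist x m = dist x y / 2 ∧ dist y m = dist x y / 2 := by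
  obtain ⟨c, hc0, hc1, hc⟩ := hX x y
  have hd : 0 ≤ dist x y := dist_nonneg
  have hmid : dist x y / 2 ∈ Set.Icc 0 (dist x y) := ⟨by positivity, half_le_self hd⟩
  refine ⟨c (dist x y / 2), ?_, ?_⟩
  · have hleft := hc 0 ⟨le_rfl, hd⟩ _ hmid
    rwa [hc0, zero_sub, abs_neg, abs_of_nonneg hmid.1] at hleft
  · have hright := hc (dist x y) ⟨hd, le_rfl⟩ _ hmid
    rwa [hc1, sub_half, abs_of_nonneg hmid.1] at hright

theorem IsGeodesicSpace.preconnectedSpace (hX : IsGeodesicSpace X) : PreconnectedSpace X := by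
  refine ⟨isPreconnected_of_forall_pair fun x _ y _ => ?_⟩
  obtain ⟨c, hc0, hc1, hc⟩ := hX x y
  have hd : 0 ≤ dist x y := dist_nonneg
  have hLip : LipschitzOnWith 1 c (Set.Icc 0 (dist x y)) :=
    LipschitzOnWith.of_dist_le_mul fun s hs t ht => by
      rw [hc s hs t ht, Real.dist_eq, NNReal.coe_one, one_mul]
  exact ⟨c '' Set.Icc 0 (dist x y), Set.subset_univ _, ⟨0, ⟨le_rfl, hd⟩, hc0⟩,
    ⟨dist x y, ⟨hd, le_rfl⟩, hc1⟩, isPreconnected_Icc.image c hLip.continuousOn⟩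

theorem busemann_le_add_dist (hσ : IsGeodesicRay σ) (x y : X) :
    busemann σ x ≤ busemann σ y + dist x y := by
  refine le_of_tendsto_of_tendsto' (tendsto_busemann hσ x)
    ((tendsto_busemann hσ y).add_const (dist x y)) fun t => ?_
  linarith [dist_triangle x y (σ t)]

theorem busemann_ray_apply (hσ : IsGeodesicRay σ) {s : ℝ} (hs : 0 ≤ s) :
    busemann σ (σ s) = -s := by
  refine tendsto_nhds_unique (tendsto_busemann hσ (σ s)) (tendsto_const_nhds.congr' ?_)
  filter_upwards [Filter.eventually_ge_atTop s] with t ht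
  rw [hσ s t hs (hs.trans ht), abs_sub_comm, abs_of_nonneg (sub_nonneg.mpr ht)]
  ring

theorem IsGromovHyperbolicWith.busemann_midpoint_le (h : IsGromovHyperbolicWith X δ)
    (hσ : IsGeodesicRay σ) {x y m : X} (hxm : dist x m = dist x y / 2)
    (hym : dist y m = dist x y / 2) :
    busemann σ m ≤ max (busemann σ x) (busemann σ y) - dist x y / 2 + 2 * δ := by
  refine le_of_tendsto_of_tendsto' (tendsto_busemann hσ m)
    ((((tendsto_busemann hσ x).max (tendsto_busemann hσ y)).sub_const _).add_const _) fun t => ?_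
  have hfour := h.dist_add_dist_le x m y (σ t)
  rw [hxm, dist_comm m y, hym, max_add_add_left, max_comm] at hfour
  rw [max_sub_sub_right]
  linarith

theorem IsGromovHyperbolicWith.dist_le_of_busemann_bounds (h : IsGromovHyperbolicWith X δ)
    (hX : IsGeodesicSpace X) (hσ : IsGeodesicRay σ) {x : ℕ → X} {k : ℕ} {L a b : ℝ}
    (hL : ∀ i, dist (x i) (x (i + 1)) ≤ L) (ha : ∀ i, a ≤ busemann σ (x i))
    (hb_start : busemann σ (x 0) ≤ b) (hb_end : busemann σ (x (2 ^ k)) ≤ b) :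
    dist (x 0) (x (2 ^ k)) ≤ 2 * (b - a + (k + 2) * δ + L) := by
  obtain ⟨m, hm_start, hm_end⟩ := hX.exists_midpoint (x 0) (x (2 ^ k))
  have hdeep := h.busemann_midpoint_le hσ hm_start hm_end
  have hproduct : gromovProduct m (x 0) (x (2 ^ k)) = 0 := by
    rw [gromovProduct, hm_start, hm_end]
    ring
  obtain ⟨i, hi⟩ := h.exists_dist_le_gromovProduct_add hL m k 0
  rw [zero_add, hproduct] at hi
  linarith [max_le hb_start hb_end, busemann_le_add_dist hσ (x i) m, ha i]

theorem IsGromovHyperbolicWith.exists_lt_busemann (h : IsGromovHyperbolicWith X δ)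
    (hσ : IsGeodesicRay σ) {ℓ : ℝ → X} (hℓ : Isometry ℓ) (C : ℝ) : ∃ x, C < busemann σ x := by
  by_contra! hC
  obtain ⟨r, hr, hCr⟩ : ∃ r : ℝ, 0 ≤ r ∧ C + 2 * δ - busemann σ (ℓ 0) < r :=
    ⟨max 0 (C + 2 * δ - busemann σ (ℓ 0) + 1), le_max_left _ _,
      (lt_add_one _).trans_le (le_max_right _ _)⟩
  have hdist : dist (ℓ (-r)) (ℓ r) = 2 * r := by
    rw [hℓ.dist_eq, Real.dist_eq, abs_of_nonpos (by linarith)]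
    ring
  have hmid := h.busemann_midpoint_le hσ (x := ℓ (-r)) (y := ℓ r) (m := ℓ 0)
    (by simp [hdist, hℓ.dist_eq, abs_of_nonneg hr])
    (by simp [hdist, hℓ.dist_eq, abs_of_nonneg hr])
  linarith [max_le (hC (ℓ (-r))) (hC (ℓ r))]

theorem IsOpenHoroball.nonempty {B : Set X} (hB : IsOpenHoroball B) : B.Nonempty := by
  obtain ⟨-, σ, hσ, C, -, hC⟩ := hB
  have hs : 0 ≤ |C| + 1 := by positivity
  refine ⟨σ (|C| + 1), by_contra fun hmem => ?_⟩
  have hlow := hC _ hmem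
  rw [busemann_ray_apply hσ hs] at hlow
  linarith [le_abs_self C]

theorem IsOpenHoroball.ne_univ (h : IsGromovHyperbolicWith X δ) {ℓ : ℝ → X} (hℓ : Isometry ℓ)
    {B : Set X} (hB : IsOpenHoroball B) : B ≠ Set.univ := by
  obtain ⟨-, σ, hσ, C, hC, -⟩ := hB
  rintro rfl
  obtain ⟨x, hx⟩ := h.exists_lt_busemann hσ hℓ C
  exact (hC x (Set.mem_univ x)).not_gt hx

end Metric

section WordLength

theorem natCast_clog_two_le_logTwoPlus_add_one (n : ℕ) :
    (Nat.clog 2 n : ℝ) ≤ logTwoPlus n + 1 := by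
  have hceil : Nat.clog 2 n ≤ ⌈logTwoPlus n⌉₊ := by
    rw [← Real.natCeil_logb_natCast]
    exact Nat.ceil_mono (le_max_left _ _)
  calc (Nat.clog 2 n : ℝ) ≤ (⌈logTwoPlus n⌉₊ : ℝ) := mod_cast hceil
    _ ≤ logTwoPlus n + 1 := (Nat.ceil_lt_add_one (le_max_right _ _)).le

variable {Γ : Type*} [Group Γ] {S : Set Γ}

theorem exists_list_length_eq_wordLength {γ : Γ} (hγ : γ ∈ Submonoid.closure S) :
    ∃ l : List Γ, l.length = wordLength S γ ∧ (∀ s ∈ l, s ∈ S) ∧ l.prod = γ := by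
  obtain ⟨l, hl, hprod⟩ := Submonoid.exists_list_of_mem_closure hγ
  exact Nat.sInf_mem
    (s := {n | ∃ l : List Γ, l.length = n ∧ (∀ s ∈ l, s ∈ S) ∧ l.prod = γ}) ⟨_, l, rfl, hl, hprod⟩

theorem IsAdapted.submonoidClosure_eq_top {Pc : Set (Subgroup Γ)} (hS : IsAdapted Pc S) :
    Submonoid.closure S = ⊤ := by
  have hinv : S⁻¹ ⊆ S := fun s hs => by simpa using hS.symmetric _ hs
  rw [← Set.union_eq_left.mpr hinv, ← Subgroup.closure_toSubmonoid, hS.generates,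
    Subgroup.top_toSubmonoid]

variable {X : Type*} [MetricSpace X] [MulAction Γ X] [IsIsometricSMul Γ X]

theorem dist_prod_take_smul_le {o : X} {L : ℝ} (hL : 0 ≤ L) {l : List Γ}
    (hl : ∀ s ∈ l, orbitNorm o s ≤ L) (i : ℕ) :
    dist ((l.take i).prod • o) ((l.take (i + 1)).prod • o) ≤ L := by
  rcases lt_or_ge i l.length with hi | hi
  · rw [List.prod_take_succ l i hi, mul_smul, dist_smul]
    exact hl _ (List.getElem_mem hi)
  · rwa [List.take_of_length_le hi, List.take_of_length_le (hi.trans i.le_succ), dist_self]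

end WordLength

section Horoballs

variable {Γ : Type*} [Group Γ] {X : Type*} [MetricSpace X] [MulAction Γ X]

/-- `𝓑` is a collection of pairwise disjoint open horoballs which is permuted by `Γ`. This is what
the logarithmic bound uses of a thick-thin decomposition; the horoballs are not indexed by
subgroups, as each one determines its stabilizer. -/
structure IsHoroballPacking (Γ : Type*) [Group Γ] {X : Type*} [MetricSpace X] [MulAction Γ X]
    (𝓑 : Set (Set X)) : Prop where
  isOpenHoroball : ∀ B ∈ 𝓑, IsOpenHoroball B
  pairwiseDisjoint : 𝓑.PairwiseDisjoint id
  smul_mem : ∀ γ : Γ, ∀ B ∈ 𝓑, γ • B ∈ 𝓑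

theorem IsThickThin.isHoroballPacking {Pc : Set (Subgroup Γ)} {B : Subgroup Γ → Set X}
    (hB : IsThickThin Pc B) : IsHoroballPacking Γ (B '' conjugates Pc) where
  isOpenHoroball := Set.forall_mem_image.mpr hB.horoball
  pairwiseDisjoint := by
    rintro _ ⟨P, hP, rfl⟩ _ ⟨Q, hQ, rfl⟩ hne
    exact hB.disjoint P hP Q hQ (ne_of_apply_ne B hne)
  smul_mem := by
    rintro γ _ ⟨P, hP, rfl⟩
    refine ⟨MulAut.conj γ • P, ?_, (hB.equivariant γ P hP).symm⟩
    obtain ⟨g, Q, hQ, rfl⟩ := hP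
    exact ⟨γ * g, Q, hQ, by rw [map_mul, mul_smul]⟩

theorem subset_conjugates (Pc : Set (Subgroup Γ)) : Pc ⊆ conjugates Pc :=
  fun P hP => ⟨1, P, hP, by simp⟩

theorem IsHoroballPacking.exists_forall_smul_notMem {𝓑 : Set (Set X)}
    (h𝓑 : IsHoroballPacking Γ 𝓑) (hX : IsGeodesicSpace X) {δ : ℝ}
    (h : IsGromovHyperbolicWith X δ) {ℓ : ℝ → X} (hℓ : Isometry ℓ) {B : Set X} (hB : B ∈ 𝓑) :
    ∃ x : X, ∀ γ : Γ, γ • x ∉ B := by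
  have := hX.preconnectedSpace
  obtain ⟨x, hx⟩ := (Set.ne_univ_iff_exists_notMem _).mp <|
    biUnion_ne_univ_of_pairwiseDisjoint (fun C hC => (h𝓑.isOpenHoroball C hC).1)
      h𝓑.pairwiseDisjoint hB (h𝓑.isOpenHoroball B hB).nonempty
      ((h𝓑.isOpenHoroball B hB).ne_univ h hℓ)
  refine ⟨x, fun γ hγ => hx (Set.mem_biUnion (h𝓑.smul_mem γ⁻¹ B hB) ?_)⟩
  exact Set.mem_inv_smul_set_iff.mpr hγ

variable [IsIsometricSMul Γ X]

theorem IsOpenHoroball.exists_busemann_bounds {B : Set X} (hB : IsOpenHoroball B) {x : X}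
    (hx : ∀ γ : Γ, γ • x ∉ B) (o : X) :
    ∃ σ : ℝ → X, IsGeodesicRay σ ∧ ∃ a b : ℝ, (∀ γ : Γ, a ≤ busemann σ (γ • o)) ∧
      ∀ γ ∈ MulAction.stabilizer Γ B, busemann σ (γ • o) ≤ b := by
  obtain ⟨p, hp⟩ := hB.nonempty
  obtain ⟨-, σ, hσ, C, hC, hC'⟩ := hB
  refine ⟨σ, hσ, -C - dist x o, C + dist o p, fun γ => ?_, fun γ hγ => ?_⟩
  · have hthick := hC' (γ • x) (hx γ)
    have hlip := busemann_le_add_dist hσ (γ • x) (γ • o)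
    rw [dist_smul] at hlip
    linarith
  · have hmem : γ • p ∈ B :=
      (MulAction.mem_stabilizer_iff.mp hγ).subset (Set.smul_mem_smul_set hp)
    have hlip := busemann_le_add_dist hσ (γ • o) (γ • p)
    rw [dist_smul] at hlip
    linarith [hC (γ • p) hmem]

theorem IsOpenHoroball.exists_orbitNorm_le (hX : IsGeodesicSpace X) {δ : ℝ} (hδ : 0 ≤ δ)
    (h : IsGromovHyperbolicWith X δ) {S : Set Γ} (hS : Submonoid.closure S = ⊤) {o : X}
    (hSo : BddAbove (orbitNorm o '' S)) {B : Set X} (hB : IsOpenHoroball B) {x : X}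
    (hx : ∀ γ : Γ, γ • x ∉ B) :
    ∃ ε : ℝ, ∀ γ ∈ MulAction.stabilizer Γ B,
      orbitNorm o γ ≤ 2 * δ * logTwoPlus (wordLength S γ : ℝ) + ε := by
  obtain ⟨σ, hσ, a, b, ha, hb⟩ := hB.exists_busemann_bounds hx o
  obtain ⟨L, hL, hSL⟩ := hSo.exists_ge 0
  refine ⟨2 * (b - a + 3 * δ + L), fun γ hγ => ?_⟩
  obtain ⟨l, hlength, hl, hprod⟩ := exists_list_length_eq_wordLength (hS.symm ▸ Submonoid.mem_top γ)
  set k := Nat.clog 2 (wordLength S γ)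
  have hend : (l.take (2 ^ k)).prod = γ := by
    rw [List.take_of_length_le (hlength.trans_le (Nat.le_pow_clog one_lt_two _)), hprod]
  have hdist := h.dist_le_of_busemann_bounds hX hσ (x := fun i => (l.take i).prod • o) (k := k)
    (dist_prod_take_smul_le hL fun s hs => hSL _ (Set.mem_image_of_mem _ (hl s hs)))
    (fun i => ha _) (hb _ (one_mem _)) (by simpa only [hend] using hb γ hγ)
  simp only [hend, List.take_zero, List.prod_nil, one_smul] at hdist
  have hlog := mul_le_mul_of_nonneg_left
    (natCast_clog_two_le_logTwoPlus_add_one (wordLength S γ)) hδ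
  rw [orbitNorm]
  linarith

end Horoballs

end RelHyp

open RelHyp in
theorem mainTheorem8_general {Γ : Type*} [Group Γ] {X : Type*} [MetricSpace X] [MulAction Γ X]
    [IsIsometricSMul Γ X] (hX : IsGeodesicSpace X) (hhyp : IsGromovHyperbolic X)
    {ℓ : ℝ → X} (hℓ : Isometry ℓ) {S : Set Γ} (hS : Submonoid.closure S = ⊤)
    {o : X} (hSo : BddAbove (orbitNorm o '' S)) {𝓑 : Set (Set X)} (h𝓑 : IsHoroballPacking Γ 𝓑)
    {𝓕 : Set (Set X)} (h𝓕 : 𝓕 ⊆ 𝓑) (hfin : 𝓕.Finite) :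
    ∃ lam ε : ℝ, 1 ≤ lam ∧ 0 ≤ ε ∧ ∀ B ∈ 𝓕, ∀ γ ∈ MulAction.stabilizer Γ B,
      orbitNorm o γ ≤ lam * logTwoPlus (wordLength S γ : ℝ) + ε := by
  obtain ⟨δ, hδ, h⟩ := hhyp
  have hbound : ∀ B ∈ 𝓕, ∃ ε : ℝ, ∀ γ ∈ MulAction.stabilizer Γ B,
      orbitNorm o γ ≤ 2 * δ * logTwoPlus (wordLength S γ : ℝ) + ε := fun B hB => by
    obtain ⟨x, hx⟩ := h𝓑.exists_forall_smul_notMem hX h hℓ (h𝓕 hB)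
    exact (h𝓑.isOpenHoroball B (h𝓕 hB)).exists_orbitNorm_le hX hδ h hS hSo hx
  choose! ε hε using hbound
  obtain ⟨E, hE, hεE⟩ := (hfin.image ε).bddAbove.exists_ge 0
  refine ⟨2 * δ + 1, E, by linarith, hE, fun B hB γ hγ => ?_⟩
  have hlog : 0 ≤ logTwoPlus (wordLength S γ : ℝ) := le_max_right _ _
  linarith [hε B hB γ hγ, hεE _ (Set.mem_image_of_mem ε hB)]

theorem mainTheorem8 {Γ : Type*} [Group Γ] (Pc : Set (Subgroup Γ))
    (S : Set Γ) (hS : RelHyp.IsAdapted Pc S)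
    (X : Type*) [MetricSpace X] [MulAction Γ X] (hX : RelHyp.IsGromovModel Pc X) (o : X) :
    ∃ lam ε : ℝ, 1 ≤ lam ∧ 0 ≤ ε ∧ ∀ P ∈ Pc, ∀ γ ∈ P,
      RelHyp.orbitNorm o γ ≤ lam * RelHyp.logTwoPlus (RelHyp.wordLength S γ : ℝ) + ε := by
  obtain ⟨B, hB⟩ := hX.thickThin
  obtain ⟨R, -, hR⟩ := hX.taut
  obtain ⟨ℓ, hℓ, -⟩ := hR o
  have := hX.isometric
  have hPc := RelHyp.subset_conjugates Pc
  obtain ⟨lam, ε, hlam, hε, hbound⟩ := mainTheorem8_general hX.geodesic hX.hyperbolic hℓ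
    hS.submonoidClosure_eq_top (hS.finite.image (RelHyp.orbitNorm o)).bddAbove
    hB.isHoroballPacking (Set.image_mono hPc) (hX.finite.image B)
  refine ⟨lam, ε, hlam, hε, fun P hP γ hγ => hbound (B P) (Set.mem_image_of_mem B hP) γ ?_⟩
  rwa [hB.stabilizer P (hPc hP)]
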